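/- Let a real algebra be a real vector space $V$ with a bilinear multiplication $\cdot : V\times V\to V$ (not assumed commutative, associative or unital). It is non-trivial if its multiplication is not identically zero, and it is called a Jordan algebra if $(u\cdot v)\cdot u^2=u\cdot(v\cdot u^2)$ for all $u,v\in V$, where $u^2=u\cdot u$. Two algebras are isomorphic if there is an invertible linear map between them that preserves products. A matrix $$A=\begin{pmatrix}\alpha_1&\alpha_2&\alpha_3&\alpha_4\\ \beta_1&\beta_2&\beta_3&\beta_4\end{pmatrix}$$ is identified with the two-dimensional real algebra with basis $e_1,e_2$ and $e_1e_1=\alpha_1e_1+\beta_1e_2$, $e_1e_2=\alpha_2e_1+\beta_2e_2$, $e_2e_1=\alpha_3e_1+\beta_3e_2$, $e_2e_2=\alpha_4e_1+\beta_4e_2$. **Theorem.** Each algebra in the following list is a non-trivial real Jordan algebra, and every non-trivial two-dimensional real Jordan algebra is isomorphic to exactly one algebra in the list: $$J_{1,r}=\begin{pmatrix}\frac12&0&0&1\\0&\frac12&\frac12&0\end{pmatrix},\quad J_{2,r}=\begin{pmatrix}\frac12&0&0&1\\0&-\frac12&\frac12&0\end{pmatrix},$$ $$J_{3,r}=\begin{pmatrix}\frac12&0&0&-1\\0&\frac12&\frac12&0\end{pmatrix},\quad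 J_{4,r}=\begin{pmatrix}\frac12&0&0&-1\\0&-\frac12&\frac12&0\end{pmatrix},$$ $$J_{5,r}(\alpha)=\begin{pmatrix}\alpha&0&0&0\\0&-1+2\alpha&-\alpha+1&0\end{pmatrix}\quad\text{for }\alpha\in\mathbb R,\ \alpha\ne\tfrac1{10}(5\pm\sqrt5),$$ $$J_{6,r}(\alpha)=\begin{pmatrix}\alpha&0&0&0\\0&\sqrt{\alpha-\alpha^2}&-\alpha+1&0\end{pmatrix}\quad\text{for }0\le\alpha\le1,$$ $$J_{7,r}(\alpha)=\begin{pmatrix}\alpha&0&0&0\\0&-\sqrt{\alpha-\alpha^2}&-\alpha+1&0\end{pmatrix}\quad\text{for }0<\alpha<1,$$ $$J_{8,r}=\begin{pmatrix}\frac1{10}(5-\sqrt5)&0&0&0\\1&-\frac{\sqrt5}5&\frac1{10}(5+\sqrt5)&0\end{pmatrix},\quad J_{9,r}=\begin{pmatrix}\frac1{10}(5+\sqrt5)&0&0&0\\1&\frac{\sqrt5}5&\frac1{10}(5-\sqrt5)&0\end{pmatrix},$$ $$J_{10,r}=\begin{pmatrix}\frac13&0&0&0\\0&\frac23&-\frac13&0\end{pmatrix},\quad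 J_{11,r}=\begin{pmatrix}0&0&0&0\\1&0&0&0\end{pmatrix}.$$ -/

import Mathlib

open Real

/-- A (not necessarily commutative or associative) real algebra is a real vector space `V` together
with a bilinear multiplication `μ : V →ₗ[ℝ] V →ₗ[ℝ] V`, where `μ u v` is the product `u · v`.
`AlgebraIso μ ν` says that `(V, μ)` and `(W, ν)` are isomorphic algebras. -/
def AlgebraIso {V W : Type*} [AddCommGroup V] [Module ℝ V] [AddCommGroup W] [Module ℝ W]
    (μ : V →ₗ[ℝ] V →ₗ[ℝ] V) (ν : W →ₗ[ℝ] W →ₗ[ℝ] W) : Prop :=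
  ∃ f : V ≃ₗ[ℝ] W, ∀ u v : V, f (μ u v) = ν (f u) (f v)

/-- The (not necessarily commutative) Jordan identity `(u · v) · u² = u · (v · u²)`. -/
def JordanIdentity {V : Type*} [AddCommGroup V] [Module ℝ V] (μ : V →ₗ[ℝ] V →ₗ[ℝ] V) : Prop :=
  ∀ u v : V, μ (μ u v) (μ u u) = μ u (μ v (μ u u))

/-- An algebra is non-trivial if its multiplication is not identically zero. -/
def NontrivialMul {V : Type*} [AddCommGroup V] [Module ℝ V] (μ : V →ₗ[ℝ] V →ₗ[ℝ] V) : Prop :=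
  ∃ u v : V, μ u v ≠ 0

/-- The Kronecker product `u ⊗ v` of two column vectors of length two. -/
def kronVec (u v : Fin 2 → ℝ) : Fin 4 → ℝ :=
  ![u 0 * v 0, u 0 * v 1, u 1 * v 0, u 1 * v 1]

/-- The two-dimensional algebra with matrix of structure constants `A`: the space of coordinate
columns with the multiplication `u · v = A (u ⊗ v)`. -/
def mscMul (A : Matrix (Fin 2) (Fin 4) ℝ) :
    (Fin 2 → ℝ) →ₗ[ℝ] (Fin 2 → ℝ) →ₗ[ℝ] (Fin 2 → ℝ) :=
  LinearMap.mk₂ ℝ (fun u v => A.mulVec (kronVec u v))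
    (fun u u' v => by
      rw [← Matrix.mulVec_add]
      congr 1
      ext i
      fin_cases i <;> simp [kronVec, add_mul])
    (fun c u v => by
      rw [← Matrix.mulVec_smul]
      congr 1
      ext i
      fin_cases i <;> simp [kronVec, mul_assoc])
    (fun u v v' => by
      rw [← Matrix.mulVec_add]
      congr 1
      ext i
      fin_cases i <;> simp [kronVec, mul_add])
    (fun c u v => by
      rw [← Matrix.mulVec_smul]
      congr 1
      ext i
      fin_cases i <;> simp [kronVec, mul_left_comm])

/-- The labels of the list: `J₁, …, J₄`, the families `J₅(α), J₆(α), J₇(α)` with their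
parameter ranges, and `J₈, …, J₁₁`. -/
inductive JordanLabel : Type
  | J1 : JordanLabel
  | J2 : JordanLabel
  | J3 : JordanLabel
  | J4 : JordanLabel
  | J5 (α : ℝ) (hplus : α ≠ (1 / 10) * (5 + √5)) (hminus : α ≠ (1 / 10) * (5 - √5)) : JordanLabel
  | J6 (α : ℝ) (hnonneg : 0 ≤ α) (hle : α ≤ 1) : JordanLabel
  | J7 (α : ℝ) (hpos : 0 < α) (hlt : α < 1) : JordanLabel
  | J8 : JordanLabel
  | J9 : JordanLabel
  | J10 : JordanLabel
  | J11 : JordanLabel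

/-- The matrix of structure constants of each algebra in the list. -/
noncomputable def JordanLabel.msc : JordanLabel → Matrix (Fin 2) (Fin 4) ℝ
  | J1 => !![1 / 2, 0, 0, 1;
             0, 1 / 2, 1 / 2, 0]
  | J2 => !![1 / 2, 0, 0, 1;
             0, -(1 / 2), 1 / 2, 0]
  | J3 => !![1 / 2, 0, 0, -1;
             0, 1 / 2, 1 / 2, 0]
  | J4 => !![1 / 2, 0, 0, -1;
             0, -(1 / 2), 1 / 2, 0]
  | J5 α _ _ => !![α, 0, 0, 0;
                   0, -1 + 2 * α, -α + 1, 0]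
  | J6 α _ _ => !![α, 0, 0, 0;
                   0, √(α - α ^ 2), -α + 1, 0]
  | J7 α _ _ => !![α, 0, 0, 0;
                   0, -√(α - α ^ 2), -α + 1, 0]
  | J8 => !![(1 / 10) * (5 - √5), 0, 0, 0;
             1, -(√5 / 5), (1 / 10) * (5 + √5), 0]
  | J9 => !![(1 / 10) * (5 + √5), 0, 0, 0;
             1, √5 / 5, (1 / 10) * (5 - √5), 0]
  | J10 => !![1 / 3, 0, 0, 0;
              0, 2 / 3, -(1 / 3), 0]
  | J11 => !![0, 0, 0, 0;
              1, 0, 0, 0]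

/-! ### Structure tables and change of basis -/

section TwoDimensional

/-! Existence starts from a nonzero vector proportional to its square: det(u, u²) is a cubic form in
u, hence odd, so it vanishes on some line. Rescaling gives e with e² = 0 or e² = e
(`isListed_of_sq_zero`, `isListed_of_idempotent`). In a basis e, f the Jordan identity becomes
polynomial equations in the structure constants, and changes of basis then lead to a few shapes:
diagonal (e² = αe, ef = xf, fe = yf, f² = 0), triangular (e² = αe + βf instead), and e² = e, ef =
±f, fe = f with f² ≠ 0.

For diagonal tables the identity amounts to (α - x - y)(x² - αy) = 0. Scaled so that α + y = 1, the
first factor gives `J5`, and the second gives `J6` and `J7` according to the sign of x. Both factors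
vanish when 5α² - 5α + 1 = 0: there `J5` would repeat the other families, and there a nonzero β can
survive, giving `J8` and `J9`. If α + y = 0, only `J10` and `J11` occur. The third shape gives `J1`
to `J4`.

For uniqueness, the functional sending u to the trace of right multiplication by u is preserved by
isomorphisms. It is zero on `J10` and `J11` and the first coordinate on all other members. An
isomorphism between the latter is therefore lower triangular with leading entry 1, which fixes α and
x, fixes the e-coefficient of f² up to a positive factor, and constrains β. -/

theorem mscMul_apply (A : Matrix (Fin 2) (Fin 4) ℝ) (u v : Fin 2 → ℝ) :
    mscMul A u v = A.mulVec (kronVec u v) := rfl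

theorem mscMul_apply_zero (A : Matrix (Fin 2) (Fin 4) ℝ) (u v : Fin 2 → ℝ) :
    mscMul A u v 0 = A 0 0 * (u 0 * v 0) + A 0 1 * (u 0 * v 1) + A 0 2 * (u 1 * v 0)
      + A 0 3 * (u 1 * v 1) := by
  simp [mscMul_apply, Matrix.mulVec, dotProduct, kronVec, Fin.sum_univ_four]

theorem mscMul_apply_one (A : Matrix (Fin 2) (Fin 4) ℝ) (u v : Fin 2 → ℝ) :
    mscMul A u v 1 = A 1 0 * (u 0 * v 0) + A 1 1 * (u 0 * v 1) + A 1 2 * (u 1 * v 0)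
      + A 1 3 * (u 1 * v 1) := by
  simp [mscMul_apply, Matrix.mulVec, dotProduct, kronVec, Fin.sum_univ_four]

theorem AlgebraIso.symm {V W : Type*} [AddCommGroup V] [Module ℝ V] [AddCommGroup W] [Module ℝ W]
    {μ : V →ₗ[ℝ] V →ₗ[ℝ] V} {ν : W →ₗ[ℝ] W →ₗ[ℝ] W} (h : AlgebraIso μ ν) : AlgebraIso ν μ := by
  obtain ⟨f, hf⟩ := h
  exact ⟨f.symm, fun u v => f.injective (by simp [hf])⟩

theorem AlgebraIso.trans {V W X : Type*} [AddCommGroup V] [Module ℝ V] [AddCommGroup W]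
    [Module ℝ W] [AddCommGroup X] [Module ℝ X] {μ : V →ₗ[ℝ] V →ₗ[ℝ] V}
    {ν : W →ₗ[ℝ] W →ₗ[ℝ] W} {ξ : X →ₗ[ℝ] X →ₗ[ℝ] X} (h : AlgebraIso μ ν)
    (h' : AlgebraIso ν ξ) : AlgebraIso μ ξ := by
  obtain ⟨f, hf⟩ := h
  obtain ⟨g, hg⟩ := h'
  exact ⟨f.trans g, fun u v => by simp [hf, hg]⟩

theorem AlgebraIso.jordanIdentity {V W : Type*} [AddCommGroup V] [Module ℝ V] [AddCommGroup W]
    [Module ℝ W] {μ : V →ₗ[ℝ] V →ₗ[ℝ] V} {ν : W →ₗ[ℝ] W →ₗ[ℝ] W} (h : AlgebraIso μ ν)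
    (hμ : JordanIdentity μ) : JordanIdentity ν := by
  obtain ⟨f, hf⟩ := h
  intro u v
  have := congrArg f (hμ (f.symm u) (f.symm v))
  simpa [hf] using this

/-- A real algebra is listed if it is isomorphic to a member of the list. -/
def IsListed {V : Type*} [AddCommGroup V] [Module ℝ V] (μ : V →ₗ[ℝ] V →ₗ[ℝ] V) : Prop :=
  ∃ j : JordanLabel, AlgebraIso μ (mscMul j.msc)

variable {V : Type*} [AddCommGroup V] [Module ℝ V]

/-- The vectors `e`, `f` form a basis of `V` in which `μ` has the given structure constants. -/
structure HasTable (μ : V →ₗ[ℝ] V →ₗ[ℝ] V) (e f : V) (α₁ α₂ α₃ α₄ β₁ β₂ β₃ β₄ : ℝ) : Prop where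
  finrank_eq : Module.finrank ℝ V = 2
  indep : LinearIndependent ℝ ![e, f]
  ee : μ e e = α₁ • e + β₁ • f
  ef : μ e f = α₂ • e + β₂ • f
  fe : μ f e = α₃ • e + β₃ • f
  ff : μ f f = α₄ • e + β₄ • f

variable {μ : V →ₗ[ℝ] V →ₗ[ℝ] V} {e f : V} {α₁ α₂ α₃ α₄ β₁ β₂ β₃ β₄ : ℝ}

theorem HasTable.algebraIso (h : HasTable μ e f α₁ α₂ α₃ α₄ β₁ β₂ β₃ β₄) :
    AlgebraIso μ (mscMul !![α₁, α₂, α₃, α₄; β₁, β₂, β₃, β₄]) := by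
  have : Module.Finite ℝ V := Module.finite_of_finrank_pos (by simp [h.finrank_eq])
  let b := basisOfLinearIndependentOfCardEqFinrank h.indep (by simp [h.finrank_eq])
  have hb0 : b 0 = e := by simp [b]
  have hb1 : b 1 = f := by simp [b]
  refine AlgebraIso.symm ⟨b.equivFun.symm, fun u v => ?_⟩
  simp only [Module.Basis.equivFun_symm_apply, Fin.sum_univ_two, hb0, hb1, mscMul_apply_zero,
    mscMul_apply_one, map_add, map_smul, LinearMap.add_apply, LinearMap.smul_apply, h.ee, h.ef,
    h.fe, h.ff]
  simp
  module

theorem HasTable.jordan (h : HasTable μ e f α₁ α₂ α₃ α₄ β₁ β₂ β₃ β₄) (hμ : JordanIdentity μ) :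
    JordanIdentity (mscMul !![α₁, α₂, α₃, α₄; β₁, β₂, β₃, β₄]) :=
  h.algebraIso.jordanIdentity hμ

theorem HasTable.listed (h : HasTable μ e f α₁ α₂ α₃ α₄ β₁ β₂ β₃ β₄) (j : JordanLabel)
    (hj : j.msc = !![α₁, α₂, α₃, α₄; β₁, β₂, β₃, β₄]) : IsListed μ :=
  ⟨j, hj ▸ h.algebraIso⟩

/-- Change of basis in a structure table. -/
theorem HasTable.change (h : HasTable μ e f α₁ α₂ α₃ α₄ β₁ β₂ β₃ β₄) (a b c d : ℝ)
    {α₁' α₂' α₃' α₄' β₁' β₂' β₃' β₄' : ℝ} (hdet : a * d - b * c ≠ 0)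
    (h1 : α₁ * (a * a) + α₂ * (a * b) + α₃ * (b * a) + α₄ * (b * b) = α₁' * a + β₁' * c)
    (h1' : β₁ * (a * a) + β₂ * (a * b) + β₃ * (b * a) + β₄ * (b * b) = α₁' * b + β₁' * d)
    (h2 : α₁ * (a * c) + α₂ * (a * d) + α₃ * (b * c) + α₄ * (b * d) = α₂' * a + β₂' * c)
    (h2' : β₁ * (a * c) + β₂ * (a * d) + β₃ * (b * c) + β₄ * (b * d) = α₂' * b + β₂' * d)
    (h3 : α₁ * (c * a) + α₂ * (c * b) + α₃ * (d * a) + α₄ * (d * b) = α₃' * a + β₃' * c)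
    (h3' : β₁ * (c * a) + β₂ * (c * b) + β₃ * (d * a) + β₄ * (d * b) = α₃' * b + β₃' * d)
    (h4 : α₁ * (c * c) + α₂ * (c * d) + α₃ * (d * c) + α₄ * (d * d) = α₄' * a + β₄' * c)
    (h4' : β₁ * (c * c) + β₂ * (c * d) + β₃ * (d * c) + β₄ * (d * d) = α₄' * b + β₄' * d) :
    HasTable μ (a • e + b • f) (c • e + d • f) α₁' α₂' α₃' α₄' β₁' β₂' β₃' β₄' := by
  have expand : ∀ p q r s : ℝ, μ (p • e + q • f) (r • e + s • f) =
      (α₁ * (p * r) + α₂ * (p * s) + α₃ * (q * r) + α₄ * (q * s)) • e +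
      (β₁ * (p * r) + β₂ * (p * s) + β₃ * (q * r) + β₄ * (q * s)) • f := by
    intro p q r s
    simp only [map_add, map_smul, LinearMap.add_apply, LinearMap.smul_apply, h.ee, h.ef, h.fe,
      h.ff]
    module
  refine ⟨h.finrank_eq, ?_, ?_, ?_, ?_, ?_⟩
  · rw [LinearIndependent.pair_iff]
    intro s t hst
    have h0 := LinearIndependent.pair_iff.1 h.indep (s * a + t * c) (s * b + t * d)
      (by rw [← hst]; module)
    constructor
    · exact (mul_eq_zero.1 (show s * (a * d - b * c) = 0 by
        linear_combination d * h0.1 - c * h0.2)).resolve_right hdet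
    · exact (mul_eq_zero.1 (show t * (a * d - b * c) = 0 by
        linear_combination a * h0.2 - b * h0.1)).resolve_right hdet
  · rw [expand, h1, h1']; module
  · rw [expand, h2, h2']; module
  · rw [expand, h3, h3']; module
  · rw [expand, h4, h4']; module

/-- The Jordan identity for `u = a e + b f` and `v = c e + d f`, in coordinates. -/
theorem HasTable.jordan_eq (h : HasTable μ e f α₁ α₂ α₃ α₄ β₁ β₂ β₃ β₄) (hμ : JordanIdentity μ)
    (a b c d : ℝ) {s t p q m n : ℝ}
    (hs : s = α₁ * (a * a) + α₂ * (a * b) + α₃ * (b * a) + α₄ * (b * b))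
    (ht : t = β₁ * (a * a) + β₂ * (a * b) + β₃ * (b * a) + β₄ * (b * b))
    (hp : p = α₁ * (a * c) + α₂ * (a * d) + α₃ * (b * c) + α₄ * (b * d))
    (hq : q = β₁ * (a * c) + β₂ * (a * d) + β₃ * (b * c) + β₄ * (b * d))
    (hm : m = α₁ * (c * s) + α₂ * (c * t) + α₃ * (d * s) + α₄ * (d * t))
    (hn : n = β₁ * (c * s) + β₂ * (c * t) + β₃ * (d * s) + β₄ * (d * t)) :
    α₁ * (p * s) + α₂ * (p * t) + α₃ * (q * s) + α₄ * (q * t) =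
      α₁ * (a * m) + α₂ * (a * n) + α₃ * (b * m) + α₄ * (b * n) ∧
    β₁ * (p * s) + β₂ * (p * t) + β₃ * (q * s) + β₄ * (q * t) =
      β₁ * (a * m) + β₂ * (a * n) + β₃ * (b * m) + β₄ * (b * n) := by
  subst hs ht hp hq hm hn
  have key := h.jordan hμ ![a, b] ![c, d]
  have k0 := congrFun key 0
  have k1 := congrFun key 1
  simp only [mscMul_apply_zero, mscMul_apply_one] at k0 k1
  simpa using And.intro k0 k1

theorem HasTable.not_all_zero (h : HasTable μ e f α₁ α₂ α₃ α₄ β₁ β₂ β₃ β₄)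
    (hμ : NontrivialMul μ) : ¬ (α₁ = 0 ∧ α₂ = 0 ∧ α₃ = 0 ∧ α₄ = 0 ∧ β₁ = 0 ∧ β₂ = 0 ∧ β₃ = 0 ∧
      β₄ = 0) := by
  rintro ⟨rfl, rfl, rfl, rfl, rfl, rfl, rfl, rfl⟩
  obtain ⟨u, v, huv⟩ := hμ
  obtain ⟨g, hg⟩ := h.algebraIso
  apply huv
  apply g.injective
  rw [hg, map_zero]
  ext i
  fin_cases i
  · simp [mscMul_apply_zero]
  · simp [mscMul_apply_one]

end TwoDimensional

/-! ### Diagonal, triangular and unital tables -/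

section TwoDimensional

variable {V : Type*} [AddCommGroup V] [Module ℝ V] {μ : V →ₗ[ℝ] V →ₗ[ℝ] V} {e f : V}

theorem isListed_of_diagonal_of_add_eq_one {α x y : ℝ} (h : HasTable μ e f α 0 0 0 0 x y 0)
    (hy : α + y = 1) (hxy : α = x + y ∨ x ^ 2 = α * y) : IsListed μ := by
  obtain rfl : y = -α + 1 := by linarith
  have root : x ^ 2 = α * (-α + 1) → IsListed μ := by
    intro hx
    have hx' : α - α ^ 2 = x ^ 2 := by linarith
    have h0 : 0 ≤ α := by nlinarith [sq_nonneg x]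
    have h1 : α ≤ 1 := by nlinarith [sq_nonneg x]
    rcases le_or_gt 0 x with hx0 | hx0
    · refine h.listed (.J6 α h0 h1) ?_
      simp only [JordanLabel.msc, hx', Real.sqrt_sq hx0]
    · have hpos : 0 < x ^ 2 := sq_pos_of_neg hx0
      refine h.listed (.J7 α (by nlinarith) (by nlinarith)) ?_
      simp only [JordanLabel.msc, hx', Real.sqrt_sq_eq_abs, abs_of_neg hx0, neg_neg]
  rcases hxy with hx | hx
  · obtain rfl : x = -1 + 2 * α := by linarith
    have h5 : √5 ^ 2 = 5 := Real.sq_sqrt (by norm_num)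
    -- At the two parameters excluded from `J5`, x² = αy holds as well, so `J6` or `J7` applies.
    by_cases hp : α = (1 / 10) * (5 + √5)
    · apply root; rw [hp]; linear_combination (1 / 20) * h5
    by_cases hm : α = (1 / 10) * (5 - √5)
    · apply root; rw [hm]; linear_combination (1 / 20) * h5
    exact h.listed (.J5 α hp hm) rfl
  · exact root hx

theorem HasTable.diagonal_relation {α x y : ℝ} (h : HasTable μ e f α 0 0 0 0 x y 0)
    (hμ : JordanIdentity μ) : α = x + y ∨ x ^ 2 = α * y := by
  have := (h.jordan_eq hμ 1 1 1 0 rfl rfl rfl rfl rfl rfl).2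
  have : (α - (x + y)) * (x ^ 2 - α * y) = 0 := by linear_combination this
  rcases mul_eq_zero.1 this with h | h
  · left; linarith
  · right; linarith

/-- Scaling e multiplies α, x, y by a common factor, so α + y can be made 1 unless it vanishes; the
exceptional case is `J10`. -/
theorem isListed_of_diagonal {α x y : ℝ} (h : HasTable μ e f α 0 0 0 0 x y 0)
    (hμ : JordanIdentity μ) (hn : NontrivialMul μ) : IsListed μ := by
  have hxy := h.diagonal_relation hμ
  by_cases hs : α + y = 0
  · obtain rfl : y = -α := by linarith
    have hα : α ≠ 0 := by
      rintro rfl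
      apply h.not_all_zero hn
      have : x = 0 := by rcases hxy with hx | hx <;> simpa [eq_comm] using hx
      simp [this]
    rcases hxy with hx | hx
    · obtain rfl : x = 2 * α := by linarith
      have h' : HasTable μ _ _ (1 / 3) 0 0 0 0 (2 / 3) (-(1 / 3)) 0 :=
        h.change (1 / (3 * α)) 0 0 1 (by simpa using hα) (by field_simp; ring) (by simp) (by simp)
          (by field_simp; ring) (by simp) (by field_simp; ring) (by simp) (by simp)
      exact h'.listed .J10 rfl
    · have : 0 < α ^ 2 := by positivity
      nlinarith [sq_nonneg x]
  · have h' : HasTable μ _ _ (α / (α + y)) 0 0 0 0 (x / (α + y)) (y / (α + y)) 0 :=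
      h.change (1 / (α + y)) 0 0 1 (by simpa using hs) (by field_simp; ring) (by simp) (by simp)
          (by field_simp; ring) (by simp) (by field_simp; ring) (by simp) (by simp)
    exact isListed_of_diagonal_of_add_eq_one h' (by field_simp) (h'.diagonal_relation hμ)

/-- Adding a multiple of f to e removes β unless α = x + y. If β ≠ 0 remains, the identity also
forces x² = αy; together with α + y = 1 this is a quadratic equation for α with roots (5 ± √5)/10.
-/
theorem isListed_of_triangular {α β x y : ℝ} (h : HasTable μ e f α 0 0 0 β x y 0)
    (hμ : JordanIdentity μ) (hn : NontrivialMul μ) : IsListed μ := by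
  by_cases hα : α = x + y
  swap
  · have hα' : α - (x + y) ≠ 0 := sub_ne_zero.2 hα
    have h' : HasTable μ _ _ α 0 0 0 0 x y 0 :=
      h.change 1 (β / (α - (x + y))) 0 1 (by simp) (by simp) (by field_simp; ring) (by simp)
        (by simp) (by simp) (by simp) (by simp) (by simp)
    exact isListed_of_diagonal h' hμ hn
  by_cases hβ : β = 0
  · subst hβ; exact isListed_of_diagonal h hμ hn
  have h1 : x ^ 2 - y ^ 2 = x * y := by
    have := (h.jordan_eq hμ 1 0 1 0 rfl rfl rfl rfl rfl rfl).2
    apply mul_left_cancel₀ hβ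
    subst hα
    linear_combination -this
  by_cases hs : α + y = 0
  · obtain rfl : y = 0 := by nlinarith [sq_nonneg x, sq_nonneg y]
    obtain rfl : x = 0 := by nlinarith
    obtain rfl : α = 0 := by linarith
    have h' : HasTable μ _ _ 0 0 0 0 1 0 0 0 :=
      h.change 1 0 0 β (by simpa using hβ) (by simp) (by simp) (by simp)
        (by simp) (by simp) (by simp) (by simp) (by simp)
    exact h'.listed .J11 rfl
  · have h' : HasTable μ _ _ (α / (α + y)) 0 0 0 1 (x / (α + y)) (y / (α + y)) 0 :=
      h.change (1 / (α + y)) 0 0 (β / (α + y) ^ 2) (by simpa using ⟨hs, hβ, hs⟩)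
        (by field_simp; ring) (by field_simp; ring) (by simp)
        (by field_simp; ring) (by simp) (by field_simp; ring) (by simp) (by simp)
    have h5 : √5 ^ 2 = 5 := Real.sq_sqrt (by norm_num)
    have hy' : y / (α + y) = 1 - α / (α + y) := by field_simp; ring
    have hx' : x / (α + y) = 2 * (α / (α + y)) - 1 := by
      field_simp; linarith
    have hq : (α / (α + y)  - (1 / 10) * (5 + √5)) * (α / (α + y)  - (1 / 10) * (5 - √5)) = 0 := by
      have : (x / (α + y)) ^ 2 - (y / (α + y)) ^ 2 = x / (α + y) * (y / (α + y)) := by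
        field_simp; linarith
      rw [hx', hy'] at this
      linear_combination (1 / 5) * this - (1 / 100) * h5
    rw [hx', hy'] at h'
    rcases mul_eq_zero.1 hq with h0 | h0
    · rw [sub_eq_zero.1 h0] at h'
      refine h'.listed .J9 ?_
      simp only [JordanLabel.msc]
      (congr! 4; ring_nf)
    · rw [sub_eq_zero.1 h0] at h'
      refine h'.listed .J8 ?_
      simp only [JordanLabel.msc]
      (congr! 4; ring_nf)

/-- Completing the square makes f² = De; the sign of D decides between ℂ, the dual numbers and ℝ ×
ℝ. -/
theorem isListed_of_unital {p q : ℝ} (h : HasTable μ e f 1 0 0 p 0 1 1 q)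
    (hμ : JordanIdentity μ) (hn : NontrivialMul μ) : IsListed μ := by
  have h1 : HasTable μ _ _ 1 0 0 (p + q ^ 2 / 4) 0 1 1 0 :=
    h.change 1 0 (-q / 2) 1 (by simp) (by ring) (by ring) (by ring) (by ring) (by ring) (by ring)
      (by ring) (by ring)
  set D := p + q ^ 2 / 4 with hD
  rcases lt_trichotomy D 0 with h0 | h0 | h0
  · have ht : √(-(1 / (2 * D))) ^ 2 = -(1 / (2 * D)) :=
      Real.sq_sqrt (by rw [neg_nonneg, one_div_nonpos]; linarith)
    have ht0 : √(-(1 / (2 * D))) ≠ 0 := by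
      rw [Real.sqrt_ne_zero', neg_pos, one_div_neg]; linarith
    set t := √(-(1 / (2 * D)))
    have ht1 : D * t ^ 2 = -(1 / 2) := by
      have hD0 : D ≠ 0 := h0.ne
      rw [ht]; field_simp
    have h' : HasTable μ _ _ (1 / 2) 0 0 (-1) 0 (1 / 2) (1 / 2) 0 :=
      h1.change (1 / 2) 0 0 t (by simpa using ht0) (by ring) (by ring) (by ring) (by ring)
        (by ring) (by ring) (by linear_combination ht1) (by ring)
    exact h'.listed .J3 rfl
  · rw [h0] at h1
    exact isListed_of_diagonal h1 hμ hn
  · have ht : √(1 / (2 * D)) ^ 2 = 1 / (2 * D) := Real.sq_sqrt (by positivity)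
    have ht0 : √(1 / (2 * D)) ≠ 0 := by positivity
    set t := √(1 / (2 * D))
    have ht1 : D * t ^ 2 = 1 / 2 := by rw [ht]; field_simp
    have h' : HasTable μ _ _ (1 / 2) 0 0 1 0 (1 / 2) (1 / 2) 0 :=
      h1.change (1 / 2) 0 0 t (by simpa using ht0) (by ring) (by ring) (by ring) (by ring)
        (by ring) (by ring) (by linear_combination ht1) (by ring)
    exact h'.listed .J1 rfl

end TwoDimensional

/-! ### Reduction of an arbitrary Jordan algebra -/

section TwoDimensional

variable {V : Type*} [AddCommGroup V] [Module ℝ V] {μ : V →ₗ[ℝ] V →ₗ[ℝ] V} {e f : V}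

theorem isListed_of_idempotent_diagonal {p q x y : ℝ} (h : HasTable μ e f 1 0 0 p 0 x y q)
    (hμ : JordanIdentity μ) (hn : NontrivialMul μ) : IsListed μ := by
  -- For u = e + bf the identity is a cubic in b without constant term; the values at b = 1, -1, 2
  -- determine its coefficients, isolated below.
  have e1 := h.jordan_eq hμ 1 1 1 0 rfl rfl rfl rfl rfl rfl
  have e2 := h.jordan_eq hμ 1 (-1) 1 0 rfl rfl rfl rfl rfl rfl
  have e3 := h.jordan_eq hμ 1 2 1 0 rfl rfl rfl rfl rfl rfl
  have f1 := h.jordan_eq hμ 1 1 0 1 rfl rfl rfl rfl rfl rfl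
  have f2 := h.jordan_eq hμ 1 (-1) 0 1 rfl rfl rfl rfl rfl rfl
  have f3 := h.jordan_eq hμ 1 2 0 1 rfl rfl rfl rfl rfl rfl
  have c3 : p * p * (1 - y) = 0 := by
        linear_combination (1 / 6) * (f3.1 - 3 * f1.1 - f2.1)
  have c1 : p * ((x + y) * (1 - x) - (1 - y)) = 0 := by
        linear_combination -1 * ((1 / 2) * (f1.1 - f2.1) - (1 / 6) * (f3.1 - 3 * f1.1 - f2.1))
  have d2 : q * (1 - x) * p = 0 := by
        linear_combination -1 * ((1 / 2) * (f1.1 + f2.1))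
  have d1 : q * (x * (x - 1) + (x + y) * (x - y)) = 0 := by
        linear_combination -1 * ((1 / 2) * (e1.2 + e2.2))
  have d3 : p * y * (1 - y) + q ^ 2 * (x - y) = 0 := by
        linear_combination -1 * ((1 / 6) * (e3.2 - 3 * e1.2 - e2.2))
  by_cases hp : p = 0
  · subst hp
    by_cases hq : q = 0
    · subst hq; exact isListed_of_diagonal h hμ hn
    have hxy : y = x := by
      have : q ^ 2 * (x - y) = 0 := by linear_combination d3
      have := (mul_eq_zero.1 this).resolve_left (pow_ne_zero 2 hq)
      linarith
    subst hxy
    have hx : y * (y - 1) = 0 := by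
      apply (mul_eq_zero.1 d1).resolve_left hq |> Eq.trans _
      ring
    rcases mul_eq_zero.1 hx with rfl | hx
    -- Here e and f/q are orthogonal idempotents, so e + f/q is a unit.
    · have h' : HasTable μ _ _ 1 0 0 0 0 1 1 1 :=
        h.change 1 (1 / q) 0 (1 / q) (by simpa using hq) (by simp) (by field_simp; ring)
          (by simp) (by field_simp; ring) (by simp) (by field_simp; ring) (by simp)
          (by field_simp; ring)
      exact isListed_of_unital h' hμ hn
    · obtain rfl : y = 1 := by linarith
      exact isListed_of_unital h hμ hn
  · obtain rfl : y = 1 := by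
      have := (mul_eq_zero.1 c3).resolve_left (mul_ne_zero hp hp)
      linarith
    have hx : (x - 1) * (x + 1) = 0 := by
      apply mul_left_cancel₀ hp
      linear_combination -c1
    rcases mul_eq_zero.1 hx with hx | hx
    · obtain rfl : x = 1 := by linarith
      exact isListed_of_unital h hμ hn
    · obtain rfl : x = -1 := by linarith
      obtain rfl : q = 0 := by
        have : q * p = 0 := by linear_combination (1 / 2) * d2
        exact (mul_eq_zero.1 this).resolve_right hp
      rcases lt_or_gt_of_ne hp with h0 | h0
      · have ht : √(-(1 / (2 * p))) ^ 2 = -(1 / (2 * p)) :=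
          Real.sq_sqrt (by rw [neg_nonneg, one_div_nonpos]; linarith)
        have ht0 : √(-(1 / (2 * p))) ≠ 0 := by
          rw [Real.sqrt_ne_zero', neg_pos, one_div_neg]; linarith
        set t := √(-(1 / (2 * p)))
        have ht1 : p * t ^ 2 = -(1 / 2) := by rw [ht]; field_simp
        have h' : HasTable μ _ _ (1 / 2) 0 0 (-1) 0 (-(1 / 2)) (1 / 2) 0 :=
          h.change (1 / 2) 0 0 t (by simpa using ht0) (by ring) (by ring) (by ring) (by ring)
            (by ring) (by ring) (by linear_combination ht1) (by ring)
        exact h'.listed .J4 rfl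
      · have ht : √(1 / (2 * p)) ^ 2 = 1 / (2 * p) := Real.sq_sqrt (by positivity)
        have ht0 : √(1 / (2 * p)) ≠ 0 := by positivity
        set t := √(1 / (2 * p))
        have ht1 : p * t ^ 2 = 1 / 2 := by rw [ht]; field_simp
        have h' : HasTable μ _ _ (1 / 2) 0 0 1 0 (-(1 / 2)) (1 / 2) 0 :=
          h.change (1 / 2) 0 0 t (by simpa using ht0) (by ring) (by ring) (by ring) (by ring)
            (by ring) (by ring) (by linear_combination ht1) (by ring)
        exact h'.listed .J2 rfl

theorem isListed_of_idempotent {a b p q x y : ℝ} (h : HasTable μ e f 1 a b p 0 x y q)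
    (hμ : JordanIdentity μ) (hn : NontrivialMul μ) : IsListed μ := by
  have comm : b * (1 - x) = a * (1 - y) := by
    linear_combination -(h.jordan_eq hμ 1 0 0 1 rfl rfl rfl rfl rfl rfl).1
  -- The two equations say that f + te is an eigenvector of left and right multiplication by e.
  suffices H : ∃ t : ℝ, a + t - x * t = 0 ∧ b + t - y * t = 0 by
    obtain ⟨t, ha, hb⟩ := H
    have h' : HasTable μ _ _ 1 0 0 (p + a * t + b * t + t ^ 2 - (q + (x + y) * t) * t)
        0 x y (q + (x + y) * t) :=
      h.change 1 0 t 1 (by simp) (by ring) (by ring) (by linear_combination ha) (by ring)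
        (by linear_combination hb) (by ring) (by ring) (by ring)
    exact isListed_of_idempotent_diagonal h' hμ hn
  by_cases hx : x = 1
  · by_cases hy : y = 1
    · subst hx hy
      have e1 := h.jordan_eq hμ 1 1 1 0 rfl rfl rfl rfl rfl rfl
      have e2 := h.jordan_eq hμ 1 (-1) 1 0 rfl rfl rfl rfl rfl rfl
      have e3 := h.jordan_eq hμ 1 2 1 0 rfl rfl rfl rfl rfl rfl
      have f1 := h.jordan_eq hμ 1 1 0 1 rfl rfl rfl rfl rfl rfl
      have f2 := h.jordan_eq hμ 1 (-1) 0 1 rfl rfl rfl rfl rfl rfl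
      have f3 := h.jordan_eq hμ 1 2 0 1 rfl rfl rfl rfl rfl rfl
      have c1 : 2 * a = b := by
        linear_combination -1 * ((1 / 2) * (e1.1 - e2.1) - (1 / 6) * (e3.1 - 3 * e1.1 - e2.1))
      have c2 : 2 * a * (q - a) = b * (q - b) := by
        linear_combination -1 * ((1 / 2) * (f1.1 - f2.1) - (1 / 6) * (f3.1 - 3 * f1.1 - f2.1))
      have : b ^ 2 = 0 := by
        rw [← c1] at c2 ⊢
        linear_combination 2 * c2
      obtain rfl : b = 0 := by simpa using this
      exact ⟨0, by linarith, by ring⟩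
    · have hy' : 1 - y ≠ 0 := sub_ne_zero.2 (Ne.symm hy)
      refine ⟨-b / (1 - y), ?_, by field_simp; ring⟩
      subst hx
      have : a = 0 := by
        have : a * (1 - y) = 0 := by linear_combination -comm
        exact (mul_eq_zero.1 this).resolve_right hy'
      rw [this]; ring
  · have hx' : 1 - x ≠ 0 := sub_ne_zero.2 (Ne.symm hx)
    refine ⟨-a / (1 - x), by field_simp; ring, ?_⟩
    field_simp; linear_combination comm

theorem isListed_of_sq_zero {a b p q x y : ℝ} (h : HasTable μ e f 0 a b p 0 x y q)
    (hμ : JordanIdentity μ) (hn : NontrivialMul μ) : IsListed μ := by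
  by_cases hx : x = 0
  · subst hx
    by_cases hy : y = 0
    · subst hy
      have h' : HasTable μ _ _ q 0 0 0 p b a 0 :=
        h.change 0 1 1 0 (by simp) (by ring) (by ring) (by ring) (by ring) (by ring) (by ring)
          (by ring) (by ring)
      exact isListed_of_triangular h' hμ hn
    -- The new second vector is fe = be + yf.
    · have h' : HasTable μ _ _ 0 (y * a) 0 (a * b * y + y ^ 2 * p - b * y * q) 0 0 y
          (b * y + y * q) :=
        h.change 1 0 b y (by simpa using hy) (by ring) (by ring) (by ring) (by ring) (by ring)
          (by ring) (by ring) (by ring)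
      generalize a * b * y + y ^ 2 * p - b * y * q = p', b * y + y * q = q', y * a = a' at h'
      have e1 := h'.jordan_eq hμ 1 1 1 0 rfl rfl rfl rfl rfl rfl
      have e2 := h'.jordan_eq hμ (-1) 1 1 0 rfl rfl rfl rfl rfl rfl
      have hy2 : y ^ 2 ≠ 0 := pow_ne_zero 2 hy
      obtain rfl : p' = 0 := by
        apply mul_left_cancel₀ hy2
        linear_combination (1 / 2) * (e1.1 - e2.1)
      obtain rfl : q' = 0 := by
        apply mul_left_cancel₀ hy2
        linear_combination (1 / 2) * (e1.2 - e2.2)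
      by_cases ha : a' = 0
      · subst ha
        exact isListed_of_diagonal h' hμ hn
      -- With ef = a'e, fe = yf and e² = f² = 0, the vector e/y + f/a' is idempotent.
      · have h'' : HasTable μ _ _ 1 y 0 0 0 (-1) 1 0 :=
          h'.change (1 / y) (1 / a') 1 0 (by simpa using ha) (by field_simp; ring) (by field_simp; ring)
            (by field_simp; ring) (by field_simp; ring) (by field_simp; ring) (by field_simp; ring)
            (by ring) (by ring)
        exact isListed_of_idempotent h'' hμ hn
  -- For u = ae + f the values at a = 0, 1, -1 separate the constant, quadratic and odd parts.
  · have e0 := h.jordan_eq hμ 0 1 1 0 rfl rfl rfl rfl rfl rfl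
    have e1 := h.jordan_eq hμ 1 1 1 0 rfl rfl rfl rfl rfl rfl
    have e2 := h.jordan_eq hμ (-1) 1 1 0 rfl rfl rfl rfl rfl rfl
    have f0 := h.jordan_eq hμ 0 1 0 1 rfl rfl rfl rfl rfl rfl
    have f1 := h.jordan_eq hμ 1 1 0 1 rfl rfl rfl rfl rfl rfl
    have f2 := h.jordan_eq hμ (-1) 1 0 1 rfl rfl rfl rfl rfl rfl
    have hx2 : x ^ 2 ≠ 0 := pow_ne_zero 2 hx
    obtain rfl : y = -x := by
      have : x + y = 0 := by
        apply mul_left_cancel₀ hx2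
        linear_combination -1 * ((1 / 2) * (e1.2 + e2.2) - e0.2)
      linarith
    obtain rfl : b = -a := by
      have : (a + b) ^ 2 = 0 := by
        apply mul_left_cancel₀ hx
        linear_combination (1 / 2) * (f1.1 + f2.1) - f0.1
      have : a + b = 0 := by simpa using this
      linarith
    obtain rfl : q = 0 := by
      apply mul_left_cancel₀ hx2
      linear_combination -1 / 2 * (e1.2 - e2.2)
    obtain rfl : p = 0 := by
      apply mul_left_cancel₀ hx2
      linear_combination e0.2
    have h' : HasTable μ _ _ 0 0 0 0 0 x (-x) 0 :=
      h.change 1 0 a x (by simpa using hx) (by ring) (by ring) (by ring) (by ring) (by ring)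
        (by ring) (by ring) (by ring)
    exact isListed_of_diagonal h' hμ hn

/-- Every two-dimensional real algebra has a nonzero vector proportional to its square. -/
theorem exists_ne_zero_mul_self_eq_smul (A : Matrix (Fin 2) (Fin 4) ℝ) :
    ∃ u : Fin 2 → ℝ, u ≠ 0 ∧ ∃ c : ℝ, mscMul A u u = c • u := by
  let u : ℝ → Fin 2 → ℝ := fun θ => ![cos θ, sin θ]
  -- This is det(u, u²); it is odd in u, and θ = π gives the negative of the vector at θ = 0.
  let q : ℝ → ℝ := fun θ => cos θ * mscMul A (u θ) (u θ) 1 - sin θ * mscMul A (u θ) (u θ) 0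
  have hq : Continuous q := by
    simp only [q, u, mscMul_apply_zero, mscMul_apply_one]
    simp only [Matrix.cons_val_zero, Matrix.cons_val_one]
    fun_prop
  have hpi : q π = -q 0 := by
    simp [q, u, mscMul_apply_zero, mscMul_apply_one]
  obtain ⟨θ, hθ⟩ : ∃ θ, q θ = 0 := by
    rcases le_total (q 0) 0 with h0 | h0
    · exact mem_range_of_exists_le_of_exists_ge hq ⟨0, h0⟩ ⟨π, by linarith⟩
    · exact mem_range_of_exists_le_of_exists_ge hq ⟨π, by linarith⟩ ⟨0, h0⟩
  have hcs := cos_sq_add_sin_sq θ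
  refine ⟨u θ, fun h => ?_, cos θ * mscMul A (u θ) (u θ) 0 + sin θ * mscMul A (u θ) (u θ) 1, ?_⟩
  · have h0 : cos θ = 0 := congrFun h 0
    have h1 : sin θ = 0 := congrFun h 1
    simp [h0, h1] at hcs
  · simp only [q] at hθ
    ext i
    fin_cases i
    · show mscMul A (u θ) (u θ) 0 = _ * cos θ
      linear_combination -(mscMul A (u θ) (u θ) 0) * hcs - sin θ * hθ
    · show mscMul A (u θ) (u θ) 1 = _ * sin θ
      linear_combination -(mscMul A (u θ) (u θ) 1) * hcs + cos θ * hθ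

theorem isListed_of_jordanIdentity (hV : Module.finrank ℝ V = 2) (hμ : JordanIdentity μ)
    (hn : NontrivialMul μ) : IsListed μ := by
  have : Module.Finite ℝ V := Module.finite_of_finrank_pos (by simp [hV])
  have coord : ∀ e f : V, LinearIndependent ℝ ![e, f] → ∀ v, ∃ a b : ℝ, v = a • e + b • f := by
    intro e f hef v
    let b := basisOfLinearIndependentOfCardEqFinrank hef (by simp [hV])
    refine ⟨b.repr v 0, b.repr v 1, ?_⟩
    conv_lhs => rw [← b.sum_repr v]
    simp [b, Fin.sum_univ_two]
  have table : ∀ e f : V, LinearIndependent ℝ ![e, f] →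
      ∃ α₁ α₂ α₃ α₄ β₁ β₂ β₃ β₄, HasTable μ e f α₁ α₂ α₃ α₄ β₁ β₂ β₃ β₄ := by
    intro e f hef
    obtain ⟨α₁, β₁, h1⟩ := coord e f hef (μ e e)
    obtain ⟨α₂, β₂, h2⟩ := coord e f hef (μ e f)
    obtain ⟨α₃, β₃, h3⟩ := coord e f hef (μ f e)
    obtain ⟨α₄, β₄, h4⟩ := coord e f hef (μ f f)
    exact ⟨α₁, α₂, α₃, α₄, β₁, β₂, β₃, β₄, hV, hef, h1, h2, h3, h4⟩
  obtain ⟨u, hu, c, hc⟩ : ∃ u : V, u ≠ 0 ∧ ∃ c : ℝ, μ u u = c • u := by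
    let b := Module.finBasisOfFinrankEq ℝ V hV
    obtain ⟨α₁, α₂, α₃, α₄, β₁, β₂, β₃, β₄, h⟩ := table (b 0) (b 1) (by
      convert b.linearIndependent using 1
      ext i; fin_cases i <;> rfl)
    obtain ⟨g, hg⟩ := h.algebraIso
    obtain ⟨u, hu, c, hc⟩ := exists_ne_zero_mul_self_eq_smul
      !![α₁, α₂, α₃, α₄; β₁, β₂, β₃, β₄]
    exact ⟨g.symm u, by simpa using hu, c, g.injective (by simp [hg, hc])⟩
  obtain ⟨e, he, d, hd, hee⟩ : ∃ e : V, e ≠ 0 ∧ ∃ d : ℝ, (d = 0 ∨ d = 1) ∧ μ e e = d • e := by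
    by_cases hc0 : c = 0
    · exact ⟨u, hu, 0, .inl rfl, by rw [hc, hc0]⟩
    · refine ⟨c⁻¹ • u, by simp [hc0, hu], 1, .inr rfl, ?_⟩
      simp [hc, smul_smul, hc0]
  obtain ⟨f, hef⟩ := exists_linearIndependent_pair_of_one_lt_finrank (R := ℝ) (by omega) he
  obtain ⟨α₁, α₂, α₃, α₄, β₁, β₂, β₃, β₄, h⟩ := table e f hef
  have h0 := LinearIndependent.pair_iff.1 hef (α₁ - d) β₁ (by
    have := h.ee.symm.trans hee
    rw [sub_smul, sub_add_eq_add_sub, this, sub_self])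
  obtain rfl : β₁ = 0 := h0.2
  obtain rfl : α₁ = d := sub_eq_zero.1 h0.1
  rcases hd with rfl | rfl
  · exact isListed_of_sq_zero h hμ hn
  · exact isListed_of_idempotent h hμ hn

end TwoDimensional

/-! ### Invariants separating the list -/

section Uniqueness

theorem trace_flip_mscMul (A : Matrix (Fin 2) (Fin 4) ℝ) (u : Fin 2 → ℝ) :
    LinearMap.trace ℝ _ ((mscMul A).flip u) = (A 0 0 + A 1 2) * u 0 + (A 0 1 + A 1 3) * u 1 := by
  rw [LinearMap.trace_eq_matrix_trace ℝ (Pi.basisFun ℝ (Fin 2)), Matrix.trace_fin_two]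
  simp [mscMul_apply_zero, mscMul_apply_one]
  ring

/-- Right multiplications by corresponding elements are conjugate under the isomorphism. -/
theorem trace_flip_eq_of_map_mul {V W : Type*} [AddCommGroup V] [Module ℝ V] [AddCommGroup W]
    [Module ℝ W] {μ : V →ₗ[ℝ] V →ₗ[ℝ] V} {ν : W →ₗ[ℝ] W →ₗ[ℝ] W} (f : V ≃ₗ[ℝ] W)
    (hf : ∀ u v, f (μ u v) = ν (f u) (f v)) (u : V) :
    LinearMap.trace ℝ _ (ν.flip (f u)) = LinearMap.trace ℝ _ (μ.flip u) := by
  rw [← LinearMap.trace_conj' (μ.flip u) f]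
  congr 1
  ext w
  simp [LinearEquiv.conj_apply, hf]

/-- An isomorphism between two algebras of the list is lower triangular once the trace form of
right multiplication is the first coordinate, which yields the invariants of the list. -/
theorem invariants_of_algebraIso {α β x y p α' β' x' y' p' : ℝ}
    (h : AlgebraIso (mscMul !![α, 0, 0, p; β, x, y, 0]) (mscMul !![α', 0, 0, p'; β', x', y', 0]))
    (hy : α + y = 1) (hy' : α' + y' = 1) :
    α = α' ∧ x = x' ∧ ∃ c d : ℝ, d ≠ 0 ∧ p = d ^ 2 * p' ∧ α * c + β * d = β' + c * (x' + y') := by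
  obtain ⟨f, hf⟩ := h
  have hfst : ∀ u, f u 0 = u 0 := by
    intro u
    have := trace_flip_eq_of_map_mul f hf u
    simpa [trace_flip_mscMul, hy, hy'] using this
  set c := f ![1, 0] 1 with hc
  set d := f ![0, 1] 1 with hd
  have hlin : ∀ u, f u 1 = u 0 * c + u 1 * d := by
    intro u
    have : u = u 0 • ![1, 0] + u 1 • ![0, 1] := by ext i; fin_cases i <;> simp
    conv_lhs => rw [this]
    rw [map_add, map_smul, map_smul]
    simp [hc, hd]
  have hd0 : d ≠ 0 := by
    intro h0
    have : f ![0, 1] = 0 := by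
      ext i; fin_cases i
      · simpa using hfst ![0, 1]
      · simpa [h0] using hlin ![0, 1]
    have := congrFun ((LinearEquiv.map_eq_zero_iff f).1 this) 1
    simp at this
  have eq0 : ∀ u v, _ := fun u v => congrFun (hf u v) 0
  have eq1 : ∀ u v, _ := fun u v => congrFun (hf u v) 1
  simp only [hfst, hlin, mscMul_apply_zero, mscMul_apply_one] at eq0 eq1
  have h220 := eq0 ![0, 1] ![0, 1]
  have h120 := eq0 ![1, 0] ![0, 1]
  have h121 := eq1 ![1, 0] ![0, 1]
  have h110 := eq0 ![1, 0] ![1, 0]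
  have h111 := eq1 ![1, 0] ![1, 0]
  simp at h220 h120 h121 h110 h111
  have hx : x = x' := by
    rcases h121 with h | h
    · exact h
    · exact absurd h hd0
  have hcp : p' * (c * c) = 0 := by
    rcases h120 with h | h | h
    · simp [h]
    · simp [h]
    · exact absurd h hd0
  refine ⟨by rw [h110, hcp, add_zero], hx, c, d, hd0, by rw [h220]; ring, ?_⟩
  rw [h111]; ring

theorem trace_sum_eq_of_algebraIso {α β x y p α' β' x' y' p' : ℝ}
    (h : AlgebraIso (mscMul !![α, 0, 0, p; β, x, y, 0]) (mscMul !![α', 0, 0, p'; β', x', y', 0]))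
    (hy : α + y = 0) : α' + y' = 0 := by
  obtain ⟨f, hf⟩ := h
  have := trace_flip_eq_of_map_mul f hf (f.symm ![1, 0])
  simpa [trace_flip_mscMul, hy] using this

theorem sub_sq_ne_of_ne {α : ℝ} (hp : α ≠ (1 / 10) * (5 + √5)) (hm : α ≠ (1 / 10) * (5 - √5)) :
    α - α ^ 2 ≠ (-1 + 2 * α) ^ 2 := by
  intro h
  have h5 : √5 ^ 2 = 5 := Real.sq_sqrt (by norm_num)
  refine mul_ne_zero (sub_ne_zero.2 hp) (sub_ne_zero.2 hm) ?_
  linear_combination -(1 / 5) * h - (1 / 100) * h5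

theorem JordanLabel.trace_sum (j : JordanLabel) :
    (j.msc 0 0 + j.msc 1 2 = 1) ∨
      (j.msc 0 0 + j.msc 1 2 = 0 ∧ (j = J10 ∨ j = J11)) := by
  cases j <;> simp [msc] <;> ring

theorem JordanLabel.msc_eta (j : JordanLabel) :
    j.msc = !![j.msc 0 0, 0, 0, j.msc 0 3; j.msc 1 0, j.msc 1 1, j.msc 1 2, 0] := by
  cases j <;> rfl

theorem JordanLabel.eq_of_algebraIso_of_trace_eq_one {j j' : JordanLabel}
    (h : AlgebraIso (mscMul j.msc) (mscMul j'.msc))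
    (hj : j.msc 0 0 + j.msc 1 2 = 1) (hj' : j'.msc 0 0 + j'.msc 1 2 = 1) : j = j' := by
  have key := h
  rw [msc_eta j, msc_eta j'] at key
  obtain ⟨hα, hx, c, d, hd, hp, hβ⟩ := invariants_of_algebraIso key hj hj'
  have hd2 : 0 < d ^ 2 := by positivity
  have h50 : 0 < √5 := by positivity
  clear key h
  cases j <;> cases j' <;>
    simp only [msc, Matrix.of_apply, Matrix.cons_val, Matrix.cons_val_zero, Matrix.cons_val_one]
      at hα hx hp hβ hj hj' <;>
    try first
      | rfl
      | (subst hα; rfl)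
      | (exfalso; linarith)
  case J5.J6 a hp5 hm5 b h0_right h1_right =>
    subst hα
    refine absurd ?_ (sub_sq_ne_of_ne hp5 hm5)
    have := Real.sq_sqrt (show 0 ≤ a - a ^ 2 by nlinarith)
    rw [hx, this]
  case J6.J5 a h0 h1 b hp5_right hm5_right =>
    subst hα
    refine absurd ?_ (sub_sq_ne_of_ne hp5_right hm5_right)
    have := Real.sq_sqrt (show 0 ≤ a - a ^ 2 by nlinarith)
    rw [← hx, this]
  case J5.J7 a hp5 hm5 b h0_right h1_right =>
    subst hα
    refine absurd ?_ (sub_sq_ne_of_ne hp5 hm5)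
    have := Real.sq_sqrt (show 0 ≤ a - a ^ 2 by nlinarith)
    rw [hx, neg_sq, this]
  case J7.J5 a h0 h1 b hp5_right hm5_right =>
    subst hα
    refine absurd ?_ (sub_sq_ne_of_ne hp5_right hm5_right)
    have := Real.sq_sqrt (show 0 ≤ a - a ^ 2 by nlinarith)
    rw [← hx, neg_sq, this]
  case J5.J8 a hp5 hm5 => exact absurd hα hm5
  case J5.J9 a hp5 hm5 => exact absurd hα hp5
  case J8.J5 a hp5 hm5 => exact absurd hα.symm hm5
  case J9.J5 a hp5 hm5 => exact absurd hα.symm hp5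
  case J6.J7 a h0 h1 b h0_right h1_right =>
    subst hα
    have := Real.sqrt_pos.2 (show 0 < a - a ^ 2 by nlinarith)
    exfalso; linarith
  case J7.J6 a h0 h1 b h0_right h1_right =>
    subst hα
    have := Real.sqrt_pos.2 (show 0 < a - a ^ 2 by nlinarith)
    exfalso; linarith
  case J6.J8 a h0 h1 =>
    have := Real.sqrt_nonneg (a - a ^ 2)
    exfalso; linarith
  case J7.J9 a h0 h1 =>
    have := Real.sqrt_nonneg (a - a ^ 2)
    exfalso; linarith
  case J8.J6 a h0 h1 =>
    have := Real.sqrt_nonneg (a - a ^ 2)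
    exfalso; linarith
  case J9.J7 a h0 h1 =>
    have := Real.sqrt_nonneg (a - a ^ 2)
    exfalso; linarith
  -- `J8` and `J9` satisfy α = x + y, so c cancels from `hβ`, which then equates zero with a nonzero
  -- number; likewise in the cases below.
  case J6.J9 a h0 h1 =>
    rw [hα] at hβ
    exfalso; linarith
  case J7.J8 a h0 h1 =>
    rw [hα] at hβ
    exfalso; linarith
  case J8.J7 a h0 h1 =>
    rw [← hx, ← hα] at hβ
    exact absurd (show d = 0 by linarith) hd
  case J9.J6 a h0 h1 =>
    rw [← hx, ← hα] at hβ
    exact absurd (show d = 0 by linarith) hd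

theorem JordanLabel.eq_of_algebraIso {j j' : JordanLabel}
    (h : AlgebraIso (mscMul j.msc) (mscMul j'.msc)) : j = j' := by
  have key := h
  rw [msc_eta j, msc_eta j'] at key
  rcases j.trace_sum with hj | ⟨hj, hjl⟩ <;> rcases j'.trace_sum with hj' | ⟨hj', hjl'⟩
  · exact eq_of_algebraIso_of_trace_eq_one h hj hj'
  · have := trace_sum_eq_of_algebraIso key.symm hj'
    linarith
  · have := trace_sum_eq_of_algebraIso key hj
    linarith
  -- In `J11` every u · u² is zero, whereas in `J10` the first basis vector has u · u² = u/9.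
  · have hne : ¬ AlgebraIso (mscMul J11.msc) (mscMul J10.msc) := by
      rintro ⟨f, hf⟩
      have hf0 := hf (f.symm ![1, 0]) (f.symm ![1, 0])
      have hf1 := hf (f.symm ![1, 0]) (mscMul J11.msc (f.symm ![1, 0]) (f.symm ![1, 0]))
      have hzero : mscMul J11.msc (f.symm ![1, 0])
          (mscMul J11.msc (f.symm ![1, 0]) (f.symm ![1, 0])) = 0 := by
        ext i
        fin_cases i <;> simp [mscMul_apply_zero, mscMul_apply_one, msc]
      rw [hzero, hf0] at hf1
      have := congrFun hf1 0
      simp [mscMul_apply_zero, mscMul_apply_one, msc] at this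
    rcases hjl with rfl | rfl <;> rcases hjl' with rfl | rfl
    · rfl
    · exact absurd h.symm hne
    · exact absurd h hne
    · rfl

end Uniqueness

/-! ### The listed algebras are Jordan and non-trivial; conclusion -/

theorem jordanIdentity_of_relations {α β x y : ℝ} (h : (α - (x + y)) * (x ^ 2 - α * y) = 0)
    (hβ : β * (x ^ 2 - α * y) = 0) : JordanIdentity (mscMul !![α, 0, 0, 0; β, x, y, 0]) := by
  intro u v
  ext i
  fin_cases i
  · simp only [Fin.zero_eta, mscMul_apply_zero, mscMul_apply_one, Matrix.of_apply, Matrix.cons_val]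
    ring
  · simp only [Fin.mk_one, mscMul_apply_zero, mscMul_apply_one, Matrix.of_apply, Matrix.cons_val]
    linear_combination u 0 ^ 2 * u 1 * v 0 * h - u 0 ^ 3 * v 0 * hβ

theorem JordanLabel.jordanIdentity (j : JordanLabel) : JordanIdentity (mscMul j.msc) := by
  have h5 : √5 ^ 2 = 5 := Real.sq_sqrt (by norm_num)
  cases j with
  | J1 | J2 | J3 | J4 =>
    intro u v
    ext i
    fin_cases i <;>
      simp only [Fin.zero_eta, Fin.mk_one, msc, mscMul_apply_zero, mscMul_apply_one,
        Matrix.of_apply, Matrix.cons_val] <;>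
      ring
  | J5 α | J10 | J11 => exact jordanIdentity_of_relations (by ring) (by ring)
  | J6 α h0 h1 | J7 α h0 h1 =>
    have h := Real.sq_sqrt (show 0 ≤ α - α ^ 2 by nlinarith)
    refine jordanIdentity_of_relations (mul_eq_zero_of_right _ ?_) (by ring)
    linear_combination h
  | J8 | J9 =>
    exact jordanIdentity_of_relations (by ring) (by linear_combination (1 / 20) * h5)

theorem JordanLabel.nontrivialMul (j : JordanLabel) : NontrivialMul (mscMul j.msc) := by
  by_contra hn
  simp only [NontrivialMul, not_exists, not_not] at hn
  have h00 := congrFun (hn ![1, 0] ![1, 0]) 0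
  have h01 := congrFun (hn ![1, 0] ![1, 0]) 1
  have h10 := congrFun (hn ![0, 1] ![1, 0]) 1
  rw [mscMul_apply_zero] at h00
  rw [mscMul_apply_one] at h01 h10
  simp at h00 h01 h10
  -- A zero product would make the trace of right multiplication by the first basis vector zero,
  -- leaving only `J10` and `J11`.
  rcases j.trace_sum with hj | ⟨-, rfl | rfl⟩
  · rw [h00, h10] at hj; norm_num at hj
  · norm_num [msc] at h00
  · norm_num [msc] at h01

theorem mainTheorem2 :
    (∀ j : JordanLabel, JordanIdentity (mscMul j.msc) ∧ NontrivialMul (mscMul j.msc)) ∧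
    (∀ (V : Type*) [AddCommGroup V] [Module ℝ V] (μ : V →ₗ[ℝ] V →ₗ[ℝ] V),
      Module.finrank ℝ V = 2 → JordanIdentity μ → NontrivialMul μ →
        ∃! j : JordanLabel, AlgebraIso μ (mscMul j.msc)) := by
  refine ⟨fun j => ⟨j.jordanIdentity, j.nontrivialMul⟩, ?_⟩
  intro V _ _ μ hV hμ hn
  obtain ⟨j, hj⟩ := isListed_of_jordanIdentity hV hμ hn
  exact ⟨j, hj, fun j' hj' => JordanLabel.eq_of_algebraIso (hj'.symm.trans hj)⟩
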